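/- Let $(M,d)$ be a compact metric space. Call $M$ purely 1-unrectifiable if for every set $A\subset\mathbb{R}$ and every Lipschitz map $\gamma: A\to M$, the Hausdorff 1-measure of $\gamma(A)$ equals $0$. Call a Lipschitz function $f: M\to\mathbb{R}$ locally flat if for every $p\in M$ $$\lim_{\substack{x,y\to p\\ x\neq y}} \frac{|f(x)-f(y)|}{d(x,y)} = 0$$ (a condition that is vacuous at isolated points $p$). Then $M$ is purely 1-unrectifiable if and only if the set of all locally flat 1-Lipschitz functions $f: M\to\mathbb{R}$ is dense, with respect to the sup-norm topology, in the set of all 1-Lipschitz functions $f: M\to\mathbb{R}$. -/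

import Mathlib

open scoped MeasureTheory Topology NNReal

/-- `M` is purely 1-unrectifiable: for every `A ⊆ ℝ` and every Lipschitz map `f : A → M`, the
Hausdorff 1-measure of `f(A)` is zero. The set `A` is arbitrary (neither closed nor measurable);
`μH[1]` is evaluated on arbitrary sets as an outer measure. -/
def PurelyOneUnrectifiable (M : Type*) [MetricSpace M] [MeasurableSpace M] [BorelSpace M] : Prop :=
  ∀ (A : Set ℝ) (f : A → M), (∃ K : ℝ≥0, LipschitzWith K f) → μH[1] (Set.range f) = 0

/-- The condition `|f x - f y| / d(x, y) → 0` as `x, y → p` with `x ≠ y`, at every point `p`.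
(It is applied below to functions that are Lipschitz.) -/
def LocallyFlat {M : Type*} [MetricSpace M] (f : M → ℝ) : Prop :=
  ∀ p : M, Filter.Tendsto (fun q : M × M => |f q.1 - f q.2| / dist q.1 q.2)
    (𝓝[{q : M × M | q.1 ≠ q.2}] (p, p)) (𝓝 0)

/-- The set of all 1-Lipschitz functions on the compact space `M`, as a topological subspace of
`C(M, ℝ)` with its sup-norm. -/
abbrev OneLipschitzFunctions (M : Type*) [MetricSpace M] [CompactSpace M] : Type _ :=
  {f : C(M, ℝ) // LipschitzWith 1 f}

/-!
# Pure 1-unrectifiability and density of locally flat functions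

Suppose first that `M` is purely 1-unrectifiable and `f` is 1-Lipschitz. Declare steps shorter than
`r` cheap, costing only `κ` times their length, and let `g x` be the infimum over all chains ending
at `x` of the value of `f` at the start plus the cost of the chain. Then `g` is `κ`-Lipschitz at
scales below `r`, still 1-Lipschitz, and at most `f`. The point is that `g → f` uniformly as `r → 0`
(`PurelyOneUnrectifiable.exists_scale`): chains violating this would have bounded length, and their
graphs over the arc length parameter would converge to the graph of a Lipschitz curve fragment. Its
image has `μH[1]`-measure zero, so `f` maps it to a compact null set, near which all the cheap
steps take place; they contribute nothing to the increment of `f`. Iterating with `κ → 0`, each time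
starting from the cost function found before instead of the distance, yields a locally flat limit
(`PurelyOneUnrectifiable.exists_locallyFlat`).

Conversely let `γ` be a `K`-Lipschitz curve fragment with compact domain `A`. By Sard's lemma
a locally flat 1-Lipschitz `g` maps `γ '' A` to a null set, so a `K`-Lipschitz extension of `g ∘ γ`
to the line can only vary across the gaps of `A`, whence
`|g (γ a) - g (γ b)| ≤ K * volume ([a, b] \ A)`. If such functions are dense, the same bound holds
for `dist (γ a) (γ b)` (`edist_le_volume_diff_of_dense`). Cutting `A` by finer and finer grids then
gives `μH[1] (γ '' A) = 0` (`hausdorffMeasure_image_eq_zero_of_edist_le`).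
-/

section LocallyFlatDensity

open Set Filter MeasureTheory Metric
open scoped ENNReal

/-! ### Graphs of Lipschitz curve fragments -/

section Graph
variable {M : Type*} [MetricSpace M]

/-- A subset of `ℝ × M` on which the second coordinate is controlled by the first is the graph of a
Lipschitz curve fragment. -/
theorem exists_lipschitzOnWith_of_graph [Nonempty M] {Γ : Set (ℝ × M)} {K : ℝ≥0}
    (h : ∀ a ∈ Γ, ∀ b ∈ Γ, dist a.2 b.2 ≤ K * dist a.1 b.1) :
    ∃ γ : ℝ → M, LipschitzOnWith K γ (Prod.fst '' Γ) ∧ γ '' (Prod.fst '' Γ) = Prod.snd '' Γ := by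
  classical
  have key : ∀ t, ∃ x, t ∈ Prod.fst '' Γ → (t, x) ∈ Γ := by
    intro t
    by_cases ht : t ∈ Prod.fst '' Γ
    · obtain ⟨⟨s, x⟩, hx, rfl⟩ := ht
      exact ⟨x, fun _ => hx⟩
    · exact ⟨Classical.arbitrary M, fun h => absurd h ht⟩
  choose γ hγ using key
  refine ⟨γ, LipschitzOnWith.of_dist_le_mul fun s hs t ht => h _ (hγ s hs) _ (hγ t ht), ?_⟩
  apply Subset.antisymm
  · rintro _ ⟨t, ht, rfl⟩
    exact ⟨_, hγ t ht, rfl⟩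
  · rintro _ ⟨a, ha, rfl⟩
    have ht : a.1 ∈ Prod.fst '' Γ := mem_image_of_mem _ ha
    refine ⟨a.1, ht, ?_⟩
    have := h _ (hγ _ ht) _ ha
    simpa using this

theorem PurelyOneUnrectifiable.hausdorffMeasure_snd_image [MeasurableSpace M] [BorelSpace M]
    (hM : PurelyOneUnrectifiable M) {Γ : Set (ℝ × M)} {K : ℝ≥0}
    (h : ∀ a ∈ Γ, ∀ b ∈ Γ, dist a.2 b.2 ≤ K * dist a.1 b.1) :
    μH[1] (Prod.snd '' Γ) = 0 := by
  rcases isEmpty_or_nonempty M with hE | hE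
  · rw [Subsingleton.elim (Prod.snd '' Γ) ∅, measure_empty]
  obtain ⟨γ, hγ, hΓ⟩ := exists_lipschitzOnWith_of_graph h
  have := hM _ ((Prod.fst '' Γ).domRestrict γ) ⟨K, hγ.to_restrict⟩
  rwa [range_domRestrict, hΓ] at this

theorem dist_snd_le_of_mem_closure {Γ : Set (ℝ × M)} {K : ℝ≥0}
    (h : ∀ a ∈ Γ, ∀ b ∈ Γ, dist a.2 b.2 ≤ K * dist a.1 b.1) :
    ∀ a ∈ closure Γ, ∀ b ∈ closure Γ, dist a.2 b.2 ≤ K * dist a.1 b.1 := by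
  intro a ha b hb
  have hc : IsClosed {q : (ℝ × M) × (ℝ × M) | dist q.1.2 q.2.2 ≤ K * dist q.1.1 q.2.1} :=
    isClosed_le (by fun_prop) (by fun_prop)
  have hs : closure (Γ ×ˢ Γ) ⊆ {q : (ℝ × M) × (ℝ × M) | dist q.1.2 q.2.2 ≤ K * dist q.1.1 q.2.1} :=
    closure_minimal (fun q hq => h _ hq.1 _ hq.2) hc
  rw [closure_prod_eq] at hs
  exact hs (show (a, b) ∈ _ from ⟨ha, hb⟩)

end Graph

/-! ### Chains with small steps -/

section Chains

/-- A discrete intermediate value theorem. -/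
theorem exists_mem_Icc_succ {a : ℕ → ℝ} {n : ℕ} (hn : 0 < n) {t : ℝ} (ht : t ∈ Icc (a 0) (a n)) :
    ∃ i < n, t ∈ Icc (a i) (a (i + 1)) := by
  induction n with
  | zero => omega
  | succ n ih =>
    rcases le_total (a n) t with h | h
    · exact ⟨n, by omega, h, ht.2⟩
    · rcases Nat.eq_zero_or_pos n with rfl | hn
      · exact ⟨0, by omega, ht⟩
      · obtain ⟨i, hi, h⟩ := ih hn ⟨ht.1, h⟩
        exact ⟨i, by omega, h⟩

/-- Every step of a real sequence either stays in `V` or is paid for by `w`; hence so is the total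
increment, up to the measure of `V`. -/
theorem ofReal_sub_le_volume_add_sum {a w : ℕ → ℝ} {n : ℕ} {V : Set ℝ} (hw : ∀ i, 0 ≤ w i)
    (h : ∀ i < n, Icc (a i) (a (i + 1)) ⊆ V ∨ a (i + 1) - a i ≤ w i) :
    ENNReal.ofReal (a n - a 0) ≤ volume V + ENNReal.ofReal (∑ i ∈ Finset.range n, w i) := by
  classical
  rcases Nat.eq_zero_or_pos n with rfl | hn
  · simp
  let I : ℕ → Set ℝ := fun i => if Icc (a i) (a (i + 1)) ⊆ V then ∅ else Icc (a i) (a (i + 1))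
  have hsub : Icc (a 0) (a n) ⊆ V ∪ ⋃ i ∈ Finset.range n, I i := by
    intro t ht
    obtain ⟨i, hi, hti⟩ := exists_mem_Icc_succ hn ht
    by_cases hV : Icc (a i) (a (i + 1)) ⊆ V
    · exact Or.inl (hV hti)
    · refine Or.inr (mem_biUnion (Finset.mem_coe.2 (Finset.mem_range.2 hi)) ?_)
      simpa [I, hV] using hti
  calc ENNReal.ofReal (a n - a 0) = volume (Icc (a 0) (a n)) := Real.volume_Icc.symm
    _ ≤ volume V + volume (⋃ i ∈ Finset.range n, I i) :=
        (measure_mono hsub).trans (measure_union_le _ _)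
    _ ≤ volume V + ∑ i ∈ Finset.range n, volume (I i) := by
        gcongr
        exact measure_biUnion_finset_le _ _
    _ ≤ volume V + ∑ i ∈ Finset.range n, ENNReal.ofReal (w i) := by
        gcongr with i hi
        by_cases hV : Icc (a i) (a (i + 1)) ⊆ V
        · simp [I, hV]
        · simp only [I, hV, if_false, Real.volume_Icc]
          exact ENNReal.ofReal_le_ofReal ((h i (Finset.mem_range.1 hi)).resolve_left hV)
    _ = _ := by rw [ENNReal.ofReal_sum_of_nonneg fun i _ => hw i]

/-- By compactness of the space of nonempty compact subsets, a sequence of such subsets has a cluster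
point for the Hausdorff distance. -/
theorem exists_frequently_hausdorff_close {X : Type*} [MetricSpace X] [CompactSpace X]
    (G : ℕ → Set X) (hG : ∀ k, (G k).Nonempty) (hc : ∀ k, IsCompact (G k)) :
    ∃ Γ : Set X, IsCompact Γ ∧ ∀ η > 0, ∃ᶠ k in atTop,
      (∀ x ∈ G k, ∃ y ∈ Γ, dist x y < η) ∧ ∀ y ∈ Γ, ∃ x ∈ G k, dist x y < η := by
  let N : ℕ → TopologicalSpace.NonemptyCompacts X := fun k => ⟨⟨G k, hc k⟩, hG k⟩
  obtain ⟨Γ, φ, hφ, hlim⟩ := CompactSpace.tendsto_subseq N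
  refine ⟨Γ, Γ.isCompact, fun η hη => ?_⟩
  have hev : ∀ᶠ k in atTop, dist (N (φ k)) Γ < η := (tendsto_order.1
    (tendsto_iff_dist_tendsto_zero.1 hlim)).2 η hη
  refine hφ.tendsto_atTop.frequently (hev.mono fun k hk => ?_).frequently
  rw [NonemptyCompacts.dist_eq] at hk
  have hfin : hausdorffEDist (N (φ k) : Set X) Γ ≠ ⊤ :=
    hausdorffEDist_ne_top_of_nonempty_of_bounded (N (φ k)).nonempty Γ.nonempty
      (N (φ k)).isCompact.isBounded Γ.isCompact.isBounded
  exact ⟨fun x hx => exists_dist_lt_of_hausdorffDist_lt hx hk hfin,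
    fun y hy => exists_dist_lt_of_hausdorffDist_lt' hy hk hfin⟩

variable {M : Type*} [MetricSpace M] [CompactSpace M] [MeasurableSpace M] [BorelSpace M]

/-- In a purely 1-unrectifiable compact space, making the steps shorter than a small `r` cheap, by any
fixed factor `δ`, does not let a chain climb along `f` for essentially less than the increment of
`f`. Otherwise cheap chains with `r → 0` have bounded length; parametrized by arc length, their
graphs subconverge to the graph of a curve fragment, whose image under `f` is null. Short steps then
take place in a thin neighbourhood of this null set, and long steps are paid for in full. -/
theorem PurelyOneUnrectifiable.exists_scale (hM : PurelyOneUnrectifiable M) {f : M → ℝ}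
    (hf : LipschitzWith 1 f) {δ ε : ℝ} (hδ : 0 < δ) (hε : 0 < ε) :
    ∃ r > 0, ∀ w : M → M → ℝ, (∀ x y, δ * dist x y ≤ w x y) →
      (∀ x y, r ≤ dist x y → f y - f x ≤ w x y) → ∀ (p : ℕ → M) (n : ℕ),
      f (p n) ≤ f (p 0) + ∑ i ∈ Finset.range n, w (p i) (p (i + 1)) + ε := by
  by_contra! H
  choose! w hδw hfw p n hp using fun k : ℕ => H (1 / ((k : ℝ) + 1)) Nat.one_div_pos_of_nat
  obtain ⟨C, hC⟩ : ∃ C, ∀ x y : M, dist x y ≤ C :=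
    (isBounded_iff.1 (isCompact_univ (X := M)).isBounded).imp fun C h x y =>
      h (mem_univ x) (mem_univ y)
  have hf1 : ∀ x y, |f x - f y| ≤ dist x y := fun x y => by
    simpa [Real.dist_eq] using hf.dist_le_mul x y
  have hw0 : ∀ k x y, 0 ≤ w k x y := fun k x y =>
    (mul_nonneg hδ.le dist_nonneg).trans (hδw k x y)
  -- The arc length parameter of the vertices of the `k`-th chain; it is bounded by `C / δ`.
  let t : ℕ → ℕ → ℝ := fun k i => ∑ j ∈ Finset.range i, dist (p k j) (p k (j + 1))
  have ht0 : ∀ k i, 0 ≤ t k i := fun k i => Finset.sum_nonneg fun _ _ => dist_nonneg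
  have htL : ∀ k, ∀ i ≤ n k, t k i ≤ C / δ := by
    intro k i hi
    rw [le_div_iff₀ hδ, mul_comm]
    have h1 : δ * t k i ≤ ∑ j ∈ Finset.range (n k), w k (p k j) (p k (j + 1)) := by
      rw [Finset.mul_sum]
      refine (Finset.sum_le_sum fun j _ => hδw k _ _).trans ?_
      exact Finset.sum_le_sum_of_subset_of_nonneg (Finset.range_mono hi) fun j _ _ => hw0 k _ _
    have h2 := hp k
    have h3 := (abs_le.1 (hf1 (p k (n k)) (p k 0))).2
    have h4 := hC (p k (n k)) (p k 0)
    linarith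
  have htd : ∀ k i j, dist (p k i) (p k j) ≤ dist (t k i) (t k j) := by
    have aux : ∀ k i j, i ≤ j → dist (p k i) (p k j) ≤ dist (t k i) (t k j) := by
      intro k i j hij
      refine (dist_le_Ico_sum_dist (p k) hij).trans ?_
      rw [Finset.sum_Ico_eq_sub _ hij, dist_comm, Real.dist_eq]
      exact le_abs_self _
    intro k i j
    rcases le_total i j with h | h
    · exact aux k i j h
    · rw [dist_comm, dist_comm (t k i)]
      exact aux k j i h
  have hL : 0 ≤ C / δ := (ht0 0 0).trans (htL 0 0 (Nat.zero_le _))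
  -- Graphs of the chains, placed in a compact space; the projection only matters for `i > n k`.
  let q : ℕ → ℕ → Icc 0 (C / δ) × M := fun k i => (projIcc 0 (C / δ) hL (t k i), p k i)
  have hq : ∀ k, ∀ i ≤ n k, ((q k i).1 : ℝ) = t k i := fun k i hi => by
    simp [q, projIcc_of_mem hL ⟨ht0 k i, htL k i hi⟩]
  obtain ⟨Γ, hΓc, hΓ⟩ := exists_frequently_hausdorff_close (fun k => q k '' Iic (n k))
    (fun k => ⟨_, mem_image_of_mem _ (mem_Iic.2 le_rfl)⟩)
    (fun k => ((finite_Iic _).image _).isCompact)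
  -- The limit set is the graph of a 1-Lipschitz curve fragment.
  have hΓL : ∀ a ∈ Γ, ∀ b ∈ Γ, dist a.2 b.2 ≤ dist a.1 b.1 := by
    intro a ha b hb
    refine le_of_forall_pos_le_add fun η hη => ?_
    obtain ⟨k, -, hk⟩ := (hΓ (η / 4) (by positivity)).exists
    obtain ⟨_, ⟨i, hi, rfl⟩, hia⟩ := hk a ha
    obtain ⟨_, ⟨j, hj, rfl⟩, hjb⟩ := hk b hb
    have e1 := htd k i j
    rw [← hq k i hi, ← hq k j hj, ← Subtype.dist_eq] at e1
    have h1 := (le_max_left _ _).trans_lt hia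
    have h2 := (le_max_right _ _).trans_lt hia
    have h3 := (le_max_left _ _).trans_lt hjb
    have h4 := (le_max_right _ _).trans_lt hjb
    have e2 := dist_triangle4 a.2 (q k i).2 (q k j).2 b.2
    have e3 := dist_triangle4 (q k i).1 a.1 b.1 (q k j).1
    rw [dist_comm a.2 (q k i).2] at e2
    rw [dist_comm b.1 (q k j).1] at e3
    change dist (q k i).2 (q k j).2 ≤ _ at e1
    linarith
  have hnull : volume (f '' (Prod.snd '' Γ)) = 0 := by
    let Γ' : Set (ℝ × M) := (fun a : Icc 0 (C / δ) × M => ((a.1 : ℝ), a.2)) '' Γ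
    have hΓ' : Prod.snd '' Γ' = Prod.snd '' Γ := by simp only [Γ', image_image]
    have h0 : μH[1] (Prod.snd '' Γ) = 0 := by
      rw [← hΓ']
      refine hM.hausdorffMeasure_snd_image (K := 1) ?_
      rintro _ ⟨a, ha, rfl⟩ _ ⟨b, hb, rfl⟩
      simpa [Subtype.dist_eq] using hΓL a ha b hb
    rw [← hausdorffMeasure_real, ← nonpos_iff_eq_zero]
    exact (hf.hausdorffMeasure_image_le zero_le_one _).trans (by simp [h0])
  have hK : IsCompact (f '' (Prod.snd '' Γ)) := (hΓc.image continuous_snd).image hf.continuous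
  have hthick := tendsto_measure_cthickening_of_isCompact (μ := volume) hK
  rw [hnull] at hthick
  have hev : ∀ᶠ η in 𝓝[>] (0 : ℝ), volume (cthickening η (f '' (Prod.snd '' Γ))) <
      ENNReal.ofReal ε := (hthick.mono_left nhdsWithin_le_nhds).eventually_lt_const (by simpa)
  obtain ⟨η, hηV, hη⟩ := (hev.and self_mem_nhdsWithin).exists
  replace hη : 0 < η := hη
  have hsmall : ∀ᶠ k : ℕ in atTop, 1 / ((k : ℝ) + 1) < η / 2 :=
    tendsto_one_div_add_atTop_nhds_zero_nat.eventually_lt_const (by positivity)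
  obtain ⟨k, ⟨hk, -⟩, hkr⟩ := ((hΓ (η / 2) (by positivity)).and_eventually hsmall).exists
  have hcover := ofReal_sub_le_volume_add_sum (a := fun i => f (p k i))
    (w := fun i => w k (p k i) (p k (i + 1))) (n := n k)
    (V := cthickening η (f '' (Prod.snd '' Γ))) (fun i => hw0 k _ _) (by
      intro i hi
      rcases lt_or_ge (dist (p k i) (p k (i + 1))) (1 / ((k : ℝ) + 1)) with h | h
      · left
        intro s hs
        obtain ⟨y, hy, hiy⟩ := hk _ ⟨i, mem_Iic.2 hi.le, rfl⟩
        have h1 : dist (p k i) y.2 < η / 2 := (le_max_right _ _).trans_lt hiy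
        refine mem_cthickening_of_dist_le s (f y.2) _ _ ⟨y.2, ⟨y, hy, rfl⟩, rfl⟩ ?_
        have h2 := abs_le.1 (hf1 (p k i) y.2)
        have h3 := abs_le.1 (hf1 (p k i) (p k (i + 1)))
        have h4 : f (p k i) ≤ s ∧ s ≤ f (p k (i + 1)) := hs
        rw [Real.dist_eq, abs_le]
        constructor <;> linarith
      · right
        exact hfw k _ _ h)
  have hS : 0 ≤ ∑ i ∈ Finset.range (n k), w k (p k i) (p k (i + 1)) :=
    Finset.sum_nonneg fun _ _ => hw0 k _ _
  have hlt : ENNReal.ofReal (f (p k (n k)) - f (p k 0)) <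
      ENNReal.ofReal ε + ENNReal.ofReal (∑ i ∈ Finset.range (n k), w k (p k i) (p k (i + 1))) :=
    hcover.trans_lt (ENNReal.add_lt_add_right ENNReal.ofReal_ne_top hηV)
  rw [← ENNReal.ofReal_add hε.le hS] at hlt
  have := hlt.trans_le (ENNReal.ofReal_le_ofReal (by linarith [hp k] :
    _ ≤ f (p k (n k)) - f (p k 0)))
  exact this.false

end Chains

/-! ### Flattening a Lipschitz function at small scales -/

section Flattening
variable {M : Type*} [MetricSpace M]

/-- `c` is a cost function for `f`: travelling from `x` to `y` costs `c x y`, which lies between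
`δ * dist x y` for some `δ > 0` and `dist x y`, and `f` increases by at most the cost. The cost need
be neither symmetric nor subadditive. -/
structure IsCostFor (f : M → ℝ) (c : M → M → ℝ) : Prop where
  exists_mul_dist_le : ∃ δ > 0, ∀ x y, δ * dist x y ≤ c x y
  le_dist : ∀ x y, c x y ≤ dist x y
  sub_le : ∀ x y, f y - f x ≤ c x y

theorem IsCostFor.lipschitzWith {f : M → ℝ} {c : M → M → ℝ} (h : IsCostFor f c) :
    LipschitzWith 1 f :=
  LipschitzWith.of_le_add fun x y => by
    have h1 := h.sub_le y x
    have h2 := h.le_dist y x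
    rw [dist_comm] at h2
    linarith

/-- If increments of `f` along chains exceed the cost of the chain by at most `ε`, then `f` can be
lowered by at most `ε` to a function whose increments are bounded by the cost: at `x` take the
infimum, over all chains ending at `x`, of the value of `f` at the start plus the cost. -/
theorem exists_infConvolution {X : Type*} {f : X → ℝ} {c : X → X → ℝ} {ε : ℝ}
    (h : ∀ (p : ℕ → X) (n : ℕ),
      f (p n) ≤ f (p 0) + ∑ i ∈ Finset.range n, c (p i) (p (i + 1)) + ε) :
    ∃ g : X → ℝ, (∀ x y, g y - g x ≤ c x y) ∧ ∀ x, f x - ε ≤ g x ∧ g x ≤ f x := by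
  let S : X → Set ℝ := fun x => {s | ∃ (p : ℕ → X) (n : ℕ), p n = x ∧
    s = f (p 0) + ∑ i ∈ Finset.range n, c (p i) (p (i + 1))}
  have hlb : ∀ x, ∀ s ∈ S x, f x - ε ≤ s := by
    rintro x _ ⟨p, n, rfl, rfl⟩
    linarith [h p n]
  have hS : ∀ x, f x ∈ S x := fun x => ⟨fun _ => x, 0, rfl, by simp⟩
  have hbdd : ∀ x, BddBelow (S x) := fun x => ⟨_, fun s hs => hlb x s hs⟩
  refine ⟨fun x => sInf (S x), fun x y => ?_, fun x =>
    ⟨le_csInf ⟨_, hS x⟩ (hlb x), csInf_le (hbdd x) (hS x)⟩⟩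
  -- A chain ending at `x` is prolonged to `y` by one more step.
  rw [sub_le_comm]
  refine le_csInf ⟨_, hS x⟩ ?_
  rintro _ ⟨p, n, rfl, rfl⟩
  rw [sub_le_iff_le_add]
  refine csInf_le (hbdd y) ⟨fun i => if i ≤ n then p i else y, n + 1, by simp, ?_⟩
  rw [Finset.sum_range_succ]
  have : ∑ i ∈ Finset.range n, c (if i ≤ n then p i else y) (if i + 1 ≤ n then p (i + 1) else y) =
      ∑ i ∈ Finset.range n, c (p i) (p (i + 1)) :=
    Finset.sum_congr rfl fun i hi => by
      have := Finset.mem_range.1 hi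
      rw [if_pos (by omega), if_pos (by omega)]
  rw [this]
  simp [add_assoc]

variable [CompactSpace M] [MeasurableSpace M] [BorelSpace M]

/-- One flattening step: `f` is perturbed by at most `ε` so that the new function has a cost which
is no larger than the old one and which is at most `κ * dist` at small scales. -/
theorem PurelyOneUnrectifiable.exists_flatter (hM : PurelyOneUnrectifiable M) {f : M → ℝ}
    {c : M → M → ℝ} (hfc : IsCostFor f c) {ε κ : ℝ} (hε : 0 < ε) (hκ : 0 < κ) :
    ∃ (g : M → ℝ) (c' : M → M → ℝ), IsCostFor g c' ∧ (∀ x y, c' x y ≤ c x y) ∧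
      (∃ r > 0, ∀ x y, dist x y < r → c' x y ≤ κ * dist x y) ∧ ∀ x, |f x - g x| ≤ ε := by
  classical
  obtain ⟨δ, hδ, hc⟩ := hfc.exists_mul_dist_le
  obtain ⟨r, hr, H⟩ := hM.exists_scale hfc.lipschitzWith (lt_min hδ hκ) hε
  let c' : M → M → ℝ := fun x y => if dist x y < r then min (c x y) (κ * dist x y) else c x y
  have hc'c : ∀ x y, c' x y ≤ c x y := fun x y => by
    by_cases h : dist x y < r
    · simp [c', h]
    · simp [c', h]
  have hc' : ∀ x y, min δ κ * dist x y ≤ c' x y := fun x y => by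
    have h1 : min δ κ * dist x y ≤ c x y :=
      (mul_le_mul_of_nonneg_right (min_le_left _ _) dist_nonneg).trans (hc x y)
    have h2 : min δ κ * dist x y ≤ κ * dist x y :=
      mul_le_mul_of_nonneg_right (min_le_right _ _) dist_nonneg
    by_cases h : dist x y < r
    · simp only [c', h, if_true]
      exact le_min h1 h2
    · simpa only [c', h, if_false] using h1
  obtain ⟨g, hg, hgf⟩ := exists_infConvolution (H c' hc' fun x y h => by
    simpa only [c', h.not_gt, if_false] using hfc.sub_le x y)
  refine ⟨g, c', ⟨⟨_, lt_min hδ hκ, hc'⟩, fun x y => (hc'c x y).trans (hfc.le_dist x y), hg⟩,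
    hc'c, ⟨r, hr, fun x y h => ?_⟩, fun x => ?_⟩
  · simp only [c', h, if_true]
    exact min_le_right _ _
  · have := hgf x
    rw [abs_le]
    constructor <;> linarith

/-- In a purely 1-unrectifiable compact space, flattening steps with `κ = 1 / (n + 1)` are iterated.
As the costs decrease, every cost also controls the limit function, which is therefore locally
flat. -/
theorem PurelyOneUnrectifiable.exists_locallyFlat (hM : PurelyOneUnrectifiable M) {f : M → ℝ}
    (hf : LipschitzWith 1 f) {ε : ℝ} (hε : 0 < ε) :
    ∃ g : M → ℝ, LipschitzWith 1 g ∧ LocallyFlat g ∧ ∀ x, dist (f x) (g x) ≤ ε := by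
  let State := {s : (M → ℝ) × (M → M → ℝ) // IsCostFor s.1 s.2}
  have step : ∀ (n : ℕ) (s : State), ∃ s' : State, (∀ x y, s'.1.2 x y ≤ s.1.2 x y) ∧
      (∃ r > 0, ∀ x y, dist x y < r → s'.1.2 x y ≤ 1 / ((n : ℝ) + 1) * dist x y) ∧
      ∀ x, |s.1.1 x - s'.1.1 x| ≤ ε / 2 / 2 ^ n := by
    intro n s
    obtain ⟨g, c, hgc, h⟩ := hM.exists_flatter s.2 (ε := ε / 2 / 2 ^ n) (by positivity)
      (Nat.one_div_pos_of_nat (α := ℝ) (n := n))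
    exact ⟨⟨(g, c), hgc⟩, h⟩
  choose next hle hflat hdist using step
  have h0 : IsCostFor f (fun x y => dist x y) := by
    refine ⟨⟨1, one_pos, fun x y => by simp⟩, fun x y => le_rfl, fun x y => ?_⟩
    have := hf.le_add_mul y x
    rw [dist_comm] at this
    simp only [NNReal.coe_one, one_mul] at this
    linarith
  let s : ℕ → State := fun n => Nat.rec ⟨(f, fun x y => dist x y), h0⟩ next n
  have hs : ∀ n, s (n + 1) = next n (s n) := fun n => rfl
  have hanti : ∀ x y, Antitone fun n => (s n).1.2 x y := fun x y =>
    antitone_nat_of_succ_le fun n => hle n (s n) x y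
  have hgeom : ∀ x n, dist ((s n).1.1 x) ((s (n + 1)).1.1 x) ≤ ε / 2 / 2 ^ n := fun x n =>
    hdist n (s n) x
  have hlim : ∀ x, ∃ a, Tendsto (fun n => (s n).1.1 x) atTop (𝓝 a) := fun x =>
    cauchySeq_tendsto_of_complete (cauchySeq_of_le_geometric_two (hgeom x))
  choose g hg using hlim
  have hgc : ∀ n x y, g y - g x ≤ (s n).1.2 x y := fun n x y => by
    refine le_of_tendsto ((hg y).sub (hg x)) ?_
    filter_upwards [eventually_ge_atTop n] with m hm
    exact ((s m).2.sub_le x y).trans (hanti x y hm)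
  refine ⟨g, LipschitzWith.of_le_add fun x y => ?_, fun p => ?_, fun x =>
    dist_le_of_le_geometric_two_of_tendsto₀ (hgeom x) (hg x)⟩
  · have := hgc 0 y x
    change g x - g y ≤ dist y x at this
    rw [dist_comm] at this
    linarith
  · rw [Metric.tendsto_nhds]
    intro η hη
    obtain ⟨n, hn⟩ := exists_nat_one_div_lt hη
    obtain ⟨r, hr, hrn⟩ := hflat n (s n)
    have hball : ball p (r / 2) ×ˢ ball p (r / 2) ∈ 𝓝 (p, p) :=
      prod_mem_nhds (ball_mem_nhds _ (by positivity)) (ball_mem_nhds _ (by positivity))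
    filter_upwards [mem_nhdsWithin_of_mem_nhds hball, self_mem_nhdsWithin] with q hq hne
    have hd : 0 < dist q.1 q.2 := dist_pos.2 hne
    have hqr : dist q.1 q.2 < r := by
      have := dist_triangle_right q.1 q.2 p
      have h1 : dist q.1 p < r / 2 := hq.1
      have h2 : dist q.2 p < r / 2 := hq.2
      linarith
    have key : |g q.1 - g q.2| ≤ 1 / ((n : ℝ) + 1) * dist q.1 q.2 := by
      have h1 := (hgc (n + 1) q.1 q.2).trans (hrn q.1 q.2 hqr)
      have h2 := (hgc (n + 1) q.2 q.1).trans (hrn q.2 q.1 (by rwa [dist_comm]))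
      rw [dist_comm q.2] at h2
      rw [abs_le]
      constructor <;> linarith
    rw [Real.dist_0_eq_abs, abs_of_nonneg (by positivity), div_lt_iff₀ hd]
    exact key.trans_lt (mul_lt_mul_of_pos_right hn hd)

end Flattening

/-! ### Density of locally flat functions kills curve fragments -/

section Converse
variable {M : Type*} [MetricSpace M]

/-- Along a Lipschitz curve fragment a locally flat function has derivative zero relative to the
domain of the fragment, so its image is null by Sard's lemma. -/
theorem LocallyFlat.volume_image_eq_zero {f : M → ℝ} (hf : LocallyFlat f) {γ : ℝ → M} {K : ℝ≥0}
    {A : Set ℝ} (hγ : LipschitzOnWith K γ A) : volume ((fun t => f (γ t)) '' A) = 0 := by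
  refine addHaar_image_eq_zero_of_det_fderivWithin_eq_zero volume
    (f' := fun _ => (0 : ℝ →L[ℝ] ℝ)) (fun t ht => ?_) (fun t _ => by simp)
  rw [hasFDerivWithinAt_iff_isLittleO, Asymptotics.isLittleO_iff]
  intro ε hε
  have h := Metric.tendsto_nhds.1 (hf (γ t)) (ε / (K + 1)) (by positivity)
  rw [eventually_nhdsWithin_iff] at h
  have hc : Tendsto (fun u => (γ u, γ t)) (𝓝[A] t) (𝓝 (γ t, γ t)) :=
    (hγ.continuousOn t ht).prodMk_nhds tendsto_const_nhds
  filter_upwards [hc.eventually h, self_mem_nhdsWithin] with u hu huA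
  simp only [_root_.zero_apply, sub_zero, Real.norm_eq_abs]
  by_cases hne : γ u = γ t
  · rw [hne, sub_self, abs_zero]
    positivity
  have hd : 0 < dist (γ u) (γ t) := dist_pos.2 hne
  have h1 := hu hne
  rw [Real.dist_0_eq_abs, abs_of_nonneg (by positivity), div_lt_iff₀ hd] at h1
  have h2 := hγ.dist_le_mul u huA t ht
  rw [Real.dist_eq] at h2
  calc |f (γ u) - f (γ t)| ≤ ε / (K + 1) * dist (γ u) (γ t) := h1.le
    _ ≤ ε / (K + 1) * (K * |u - t|) := by gcongr
    _ ≤ ε / (K + 1) * ((K + 1) * |u - t|) := by gcongr; linarith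
    _ = ε * |u - t| := by field_simp

/-- A locally flat 1-Lipschitz function can only vary along a curve fragment across the gaps of its
domain. -/
theorem LocallyFlat.edist_le_volume_diff {f : M → ℝ} (hf : LocallyFlat f) (hf1 : LipschitzWith 1 f)
    {γ : ℝ → M} {K : ℝ≥0} {A : Set ℝ} (hγ : LipschitzOnWith K γ A) {a b : ℝ} (ha : a ∈ A)
    (hb : b ∈ A) : edist (f (γ a)) (f (γ b)) ≤ K * volume (uIcc a b \ A) := by
  have hL : LipschitzOnWith K (fun t => f (γ t)) A := by
    simpa [Function.comp_def] using hf1.comp_lipschitzOnWith hγ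
  obtain ⟨F, hF, hFA⟩ := hL.extend_real
  have hsub : uIcc (F a) (F b) ⊆ F '' A ∪ F '' (uIcc a b \ A) := by
    refine (intermediate_value_uIcc hF.continuous.continuousOn).trans ?_
    rw [← image_union]
    exact image_mono fun t ht => by by_cases h : t ∈ A <;> simp [h, ht]
  calc edist (f (γ a)) (f (γ b)) = volume (uIcc (F a) (F b)) := by
        rw [Real.volume_interval, edist_comm, edist_dist, Real.dist_eq, ← hFA ha, ← hFA hb]
    _ ≤ volume (F '' A) + volume (F '' (uIcc a b \ A)) :=
        (measure_mono hsub).trans (measure_union_le _ _)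
    _ ≤ 0 + K * volume (uIcc a b \ A) := by
        gcongr
        · rw [← hFA.image_eq, hf.volume_image_eq_zero hγ]
        · simpa [hausdorffMeasure_real] using
            hF.hausdorffMeasure_image_le zero_le_one (uIcc a b \ A)
    _ = _ := zero_add _

/-- If a curve fragment moves only across the gaps of its compact domain `A`, its image is
`μH[1]`-null: cut `A` by a grid of mesh `e`; the pieces of the image have total diameter at most
`K` times the measure of the `e`-thickening of `A` minus `A`. -/
theorem hausdorffMeasure_image_eq_zero_of_edist_le [MeasurableSpace M] [BorelSpace M]
    {γ : ℝ → M} {K : ℝ≥0} {A : Set ℝ} (hA : IsCompact A)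
    (h : ∀ a ∈ A, ∀ b ∈ A, edist (γ a) (γ b) ≤ K * volume (uIcc a b \ A)) :
    μH[1] (γ '' A) = 0 := by
  let e : ℕ → ℝ := fun n => 1 / ((n : ℝ) + 1)
  have he0 : ∀ n, 0 < e n := fun n => Nat.one_div_pos_of_nat
  have he : Tendsto e atTop (𝓝 0) := tendsto_one_div_add_atTop_nhds_zero_nat
  let I : ℕ → ℤ → Set ℝ := fun n k => Ioc (k • e n) ((k + 1) • e n)
  have hI : ∀ n k, MeasurableSet (I n k) := fun n k => measurableSet_Ioc
  have hdiam : ∀ n k, ediam (γ '' (A ∩ I n k)) ≤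
      K * volume (I n k ∩ (cthickening (e n) A \ A)) := by
    intro n k
    refine ediam_le ?_
    rintro _ ⟨a, ⟨ha, haI⟩, rfl⟩ _ ⟨b, ⟨hb, hbI⟩, rfl⟩
    refine (h a ha b hb).trans ?_
    gcongr
    rintro t ⟨ht, htA⟩
    have htI : t ∈ I n k := (ordConnected_Ioc.uIcc_subset haI hbI) ht
    refine ⟨htI, mem_cthickening_of_dist_le t a _ _ ha ?_, htA⟩
    have h1 := Real.dist_le_of_mem_Icc (Ioc_subset_Icc_self htI) (Ioc_subset_Icc_self haI)
    rwa [← sub_smul, add_sub_cancel_left, one_smul] at h1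
  have hlim : Tendsto (fun n => K * volume (cthickening (e n) A \ A)) atTop (𝓝 0) := by
    have h1 : Tendsto (fun n => volume (cthickening (e n) A) - volume A) atTop (𝓝 0) := by
      have := ENNReal.Tendsto.sub ((tendsto_measure_cthickening_of_isCompact (μ := volume)
        hA).comp he) (tendsto_const_nhds (x := volume A)) (Or.inl hA.measure_lt_top.ne)
      simpa using this
    have h2 := ENNReal.Tendsto.const_mul (a := (K : ℝ≥0∞)) h1 (Or.inr ENNReal.coe_ne_top)
    rw [mul_zero] at h2
    refine h2.congr fun n => ?_
    rw [measure_sdiff (self_subset_cthickening A) hA.measurableSet.nullMeasurableSet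
      hA.measure_lt_top.ne]
  have hle := Measure.hausdorffMeasure_le_liminf_tsum (l := atTop) 1 (γ '' A)
    (fun n => K * volume (cthickening (e n) A \ A)) hlim (fun n k => γ '' (A ∩ I n k))
    (Eventually.of_forall fun n k => (hdiam n k).trans (by gcongr; exact inter_subset_right))
    (Eventually.of_forall fun n => by
      rw [← image_iUnion, ← inter_iUnion, iUnion_Ioc_zsmul (he0 n), inter_univ])
  rw [← nonpos_iff_eq_zero, ← hlim.liminf_eq]
  refine hle.trans (liminf_le_liminf (Eventually.of_forall fun n => ?_))
  simp only [ENNReal.rpow_one]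
  calc ∑' k, ediam (γ '' (A ∩ I n k))
      ≤ ∑' k, K * volume (I n k ∩ (cthickening (e n) A \ A)) := ENNReal.tsum_le_tsum (hdiam n)
    _ = K * ∑' k, volume (I n k ∩ (cthickening (e n) A \ A)) := ENNReal.tsum_mul_left
    _ = K * volume (⋃ k, I n k ∩ (cthickening (e n) A \ A)) := by
        rw [measure_iUnion]
        · exact fun i j hij => (pairwise_disjoint_Ioc_zsmul (e n) hij).mono
            inter_subset_left inter_subset_left
        · exact fun k => (hI n k).inter (isClosed_cthickening.measurableSet.diff hA.measurableSet)
    _ = K * volume (cthickening (e n) A \ A) := by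
        rw [← iUnion_inter, iUnion_Ioc_zsmul (he0 n), univ_inter]

variable [CompactSpace M]

/-- If locally flat functions are dense, the estimate they satisfy along a curve fragment passes to
the limit function `dist · (γ a)`, hence to the curve fragment itself. -/
theorem edist_le_volume_diff_of_dense
    (hd : Dense {f : OneLipschitzFunctions M | LocallyFlat (f.1 : M → ℝ)})
    {γ : ℝ → M} {K : ℝ≥0} {A : Set ℝ} (hγ : LipschitzOnWith K γ A) {a b : ℝ} (ha : a ∈ A)
    (hb : b ∈ A) : edist (γ a) (γ b) ≤ K * volume (uIcc a b \ A) := by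
  let f : OneLipschitzFunctions M :=
    ⟨⟨fun x => dist x (γ a), by fun_prop⟩, LipschitzWith.dist_left (γ a)⟩
  have hfin : volume (uIcc a b \ A) ≠ ∞ :=
    ((measure_mono sdiff_subset).trans_lt isCompact_uIcc.measure_lt_top).ne
  have hfin' : (K : ℝ≥0∞) * volume (uIcc a b \ A) ≠ ∞ := ENNReal.mul_ne_top ENNReal.coe_ne_top hfin
  rw [edist_dist, ENNReal.ofReal_le_iff_le_toReal hfin']
  refine le_of_forall_pos_le_add fun ε hε => ?_
  obtain ⟨g, hg, hfg⟩ := Metric.dense_iff.1 hd f (ε / 2) (by positivity)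
  have hfg' : ∀ x, dist (g.1 x) (f.1 x) < ε / 2 := fun x =>
    (ContinuousMap.dist_apply_le_dist x).trans_lt hg
  have h1 := LocallyFlat.edist_le_volume_diff hfg g.2 hγ ha hb
  rw [edist_dist, ENNReal.ofReal_le_iff_le_toReal hfin'] at h1
  have h2 := hfg' (γ a)
  have h3 := hfg' (γ b)
  have h4 : f.1 (γ a) = 0 := dist_self _
  have h5 : f.1 (γ b) = dist (γ a) (γ b) := dist_comm _ _
  rw [Real.dist_eq, abs_lt] at h2 h3
  rw [Real.dist_eq, abs_le] at h1
  linarith [h1.1, h1.2, h2.1, h2.2, h3.1, h3.2]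

/-- An arbitrary curve fragment is a countable union of fragments with bounded domain, and these
extend to compact domains because the closures of their graphs are again graphs. -/
theorem purelyOneUnrectifiable_of_dense [MeasurableSpace M] [BorelSpace M]
    (hd : Dense {f : OneLipschitzFunctions M | LocallyFlat (f.1 : M → ℝ)}) :
    PurelyOneUnrectifiable M := by
  rintro A f ⟨K, hf⟩
  rcases isEmpty_or_nonempty M with hE | hE
  · rw [Subsingleton.elim (range f) ∅, measure_empty]
  let Γ : ℕ → Set (ℝ × M) := fun m =>
    (fun t : A => ((t : ℝ), f t)) '' {t | (t : ℝ) ∈ Icc (-m : ℝ) m}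
  have hcover : range f ⊆ ⋃ m, Prod.snd '' closure (Γ m) := by
    rintro _ ⟨t, rfl⟩
    obtain ⟨m, hm⟩ := exists_nat_ge |(t : ℝ)|
    exact mem_iUnion.2 ⟨m, ((t : ℝ), f t), subset_closure ⟨t, abs_le.1 hm, rfl⟩, rfl⟩
  refine measure_mono_null hcover (measure_iUnion_null fun m => ?_)
  have hΓ : ∀ a ∈ Γ m, ∀ b ∈ Γ m, dist a.2 b.2 ≤ K * dist a.1 b.1 := by
    rintro _ ⟨s, -, rfl⟩ _ ⟨t, -, rfl⟩
    exact hf.dist_le_mul s t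
  have hc : IsCompact (closure (Γ m)) := by
    refine (isCompact_Icc (a := (-m : ℝ)) (b := m)).prod isCompact_univ |>.closure_of_subset ?_
    rintro _ ⟨t, ht, rfl⟩
    exact ⟨ht, mem_univ _⟩
  obtain ⟨γ, hγ, himg⟩ := exists_lipschitzOnWith_of_graph (dist_snd_le_of_mem_closure hΓ)
  rw [← himg]
  exact hausdorffMeasure_image_eq_zero_of_edist_le (hc.image continuous_fst) fun a ha b hb =>
    edist_le_volume_diff_of_dense hd hγ ha hb

end Converse

end LocallyFlatDensity

theorem mainTheorem2 (M : Type*) [MetricSpace M] [CompactSpace M] [MeasurableSpace M]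
    [BorelSpace M] :
    PurelyOneUnrectifiable M ↔
      Dense {f : OneLipschitzFunctions M | LocallyFlat (f.1 : M → ℝ)} := by
  refine ⟨fun hM => Metric.dense_iff.2 fun f ε hε => ?_, purelyOneUnrectifiable_of_dense⟩
  obtain ⟨g, hg, hflat, hfg⟩ := hM.exists_locallyFlat f.2 (half_pos hε)
  refine ⟨⟨⟨g, hg.continuous⟩, hg⟩, ?_, hflat⟩
  rw [Metric.mem_ball, dist_comm]
  exact ((ContinuousMap.dist_le (half_pos hε).le).2 hfg).trans_lt (half_lt_self hε)
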